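/- **Theorem (Retraction via Lyapunov tracing).** Let $f:\mathbb{R}^n\to\mathbb{R}^n$ be $C^1$, let $\varphi:\mathbb{R}\times\mathbb{R}^n\to\mathbb{R}^n$ be the flow generated by $\dot{\bf x}=f({\bf x})$ (assumed to be globally defined), and let ${\bf x}^\ast$ be an equilibrium, $f({\bf x}^\ast)={\bf 0}$. Let $Y$ be a real symmetric matrix and $L({\bf x})=({\bf x}-{\bf x}^\ast)^TY({\bf x}-{\bf x}^\ast)$. Let $D_L\subset\mathbb{R}^n$ be a compact star-shaped set containing ${\bf x}^\ast$ and no other equilibrium, on which $L$ is a Lyapunov function: for all ${\bf x}\in D_L$, $\frac{d}{dt}L(\varphi(t,{\bf x}))|_{t=0}\le 0$, with equality only if ${\bf x}$ is an equilibrium. Put $$b_s:=L^{-1}(0)\cap D_L,\qquad B_s^+:=D_L\cap L^{-1}(0,\infty),\qquad B_s:=D_L\cap L^{-1}[0,\infty)=B_s^+\cup b_s .$$ Assume that the topological boundary of $B_s^+$ is the union of $b_s$ and a collection of sets $\{S_i\}$ (for instance hypersurfaces) that are immediate entrances: for every ${\bf x}\in S_i$ there is $\epsilon_{\bf x}>0$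 such that $$\varphi((0,\epsilon_{\bf x}),{\bf x})\subset{\rm int}\,B_s^+,\qquad \varphi((-\epsilon_{\bf x},0),{\bf x})\cap{\rm int}\,B_s^+=\emptyset .$$ For ${\bf x}\in B_s$ let $\tau({\bf x}):=\sup\{t\ge 0\mid\varphi([0,t],{\bf x})\subset B_s\}\in[0,\infty]$, and let $R({\bf x}):=\varphi(\tau({\bf x}),{\bf x})$ if $\tau({\bf x})<\infty$ and $R({\bf x}):=\lim_{t\to\infty}\varphi(t,{\bf x})$ if $\tau({\bf x})=\infty$. Then, whenever $\tau({\bf x})=\infty$, this limit exists and equals ${\bf x}^\ast$; $R$ maps $B_s$ into $b_s$; $R:B_s\to b_s$ is continuous; and $b_s$ is a strong deformation retract of $B_s$, i.e. there is a continuous map $H:B_s\times[0,1]\to B_s$ with $H({\bf x},0)={\bf x}$ and $H({\bf x},1)\in b_s$ for all ${\bf x}\in B_s$, and $H({\bf x},t)={\bf x}$ for all ${\bf x}\in b_s$, $t\in[0,1]$. -/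

import Mathlib

open Set Filter Topology

/-- `φ` is the (global) flow generated by the autonomous equation `x' = f x`. -/
def IsFlowOf {E : Type*} [NormedAddCommGroup E] [NormedSpace ℝ E]
    (f : E → E) (φ : Flow ℝ E) : Prop :=
  ∀ (x : E) (t : ℝ), HasDerivAt (fun s : ℝ => φ s x) (f (φ t x)) t

/-- `L` is a Lyapunov function on `D` for the flow `φ` of `x' = f x`: it is `C¹` near `D`, its
derivative along every orbit through a point of `D` is nonpositive there, and that derivative
vanishes only at equilibria. -/
structure IsLyapunovOn {E : Type*} [NormedAddCommGroup E] [NormedSpace ℝ E]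
    (f : E → E) (φ : Flow ℝ E) (L : E → ℝ) (D : Set E) : Prop where
  contDiffOn : ∃ U : Set E, IsOpen U ∧ D ⊆ U ∧ ContDiffOn ℝ 1 L U
  deriv_nonpos : ∀ x ∈ D, deriv (fun t : ℝ => L (φ t x)) 0 ≤ 0
  equilibrium_of_deriv_eq_zero : ∀ x ∈ D, deriv (fun t : ℝ => L (φ t x)) 0 = 0 → f x = 0

/-- The quadratic function `L x = (x - x₀)ᵀ Y (x - x₀)`. -/
def quadForm {n : ℕ} (Y : Matrix (Fin n) (Fin n) ℝ) (x₀ x : EuclideanSpace ℝ (Fin n)) : ℝ :=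
  (x - x₀).ofLp ⬝ᵥ Y.mulVec (x - x₀).ofLp

/-- Every point `x` of `S` is an immediate entrance point of `B`: its orbit lies in the interior
of `B` for small positive times and off the interior of `B` for small negative times. -/
def IsImmediateEntrance {E : Type*} [TopologicalSpace E]
    (φ : Flow ℝ E) (B S : Set E) : Prop :=
  ∀ x ∈ S, ∃ ε : ℝ, 0 < ε ∧
    (∀ t ∈ Ioo 0 ε, φ t x ∈ interior B) ∧ (∀ t ∈ Ioo (-ε) 0, φ t x ∉ interior B)

/-- The exit time `sup {t ≥ 0 | φ([0,t], x) ⊆ B}`, which may be `⊤`. -/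
noncomputable def exitTime {E : Type*} [TopologicalSpace E]
    (φ : Flow ℝ E) (B : Set E) (x : E) : EReal :=
  sSup ((fun t : ℝ => (t : EReal)) '' {t : ℝ | 0 ≤ t ∧ ∀ s ∈ Icc 0 t, φ s x ∈ B})

open Classical in
/-- The exit map `x ↦ φ(τ(x), x)`, with `τ` the exit time from `B`. If `τ(x) = ∞`, then
`φ(∞, x)` is the limit of `φ(t, x)` as `t → ∞`. -/
noncomputable def exitMap {E : Type*} [TopologicalSpace E] [Nonempty E]
    (φ : Flow ℝ E) (B : Set E) (x : E) : E :=
  if exitTime φ B x = ⊤ then limUnder atTop (fun t : ℝ => φ t x)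
  else φ (exitTime φ B x).toReal x

/-- `A` is a strong deformation retract of `X`. -/
def IsStrongDeformationRetract {E : Type*} [TopologicalSpace E] (A X : Set E) : Prop :=
  A ⊆ X ∧ ∃ H : E × ℝ → E,
    ContinuousOn H (X ×ˢ Icc (0 : ℝ) 1) ∧
    MapsTo H (X ×ˢ Icc (0 : ℝ) 1) X ∧
    (∀ x ∈ A, ∀ t ∈ Icc (0 : ℝ) 1, H (x, t) = x) ∧
    (∀ x ∈ X, H (x, 1) ∈ A) ∧
    (∀ x ∈ X, H (x, 0) = x)

/-!
Write `B = D ∩ {L ≥ 0}`. Off the equilibrium `p`, the function `L` decreases strictly along the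
orbits in `D`, and where `L > 0` an orbit in `D` stays in `D` for a short time: such a point is
interior to `D ∩ {L > 0}`, or it is on the boundary and hence an immediate entrance
(`eventually_mem_of_frontier_eq`). So orbits leave `B` only through `L = 0`
(`IsLyapunovTracing.map_flow_exitTime`), and they cross this level strictly, which makes the exit
time a continuous function on `B`, with values in `[0, ∞]`, except at `p`
(`IsLyapunovTracing.continuousWithinAt_exitTime`). An orbit that never leaves the compact set `B`
has no limit point other than `p`, since `L` is constant on its limit set
(`IsLyapunovTracing.tendsto_of_exitTime_eq_top`).

What remains is continuity where the exit time is infinite. There the point is that `p` is stable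
for orbit segments in `B` (`IsLyapunovTracing.exists_stable`): `L` is between `0` and its small
initial value along a segment that starts near `p`, while moving away from `p` costs `L` an amount
that is bounded below by compactness.

Both facts together show that the flow stopped at the exit time, `(x, T) ↦ φ (min (τ x) T) x` with
`φ ∞ x` the limit of the orbit, is jointly continuous on `B × [0, ∞]`
(`IsLyapunovTracing.continuousOn_stoppedFlow`). At `T = ∞` it is the exit map, and a homeomorphism
of `[0, 1]` with `[0, ∞]` turns it into the deformation of `B` onto `B ∩ {L = 0}`.
-/

/-! ### Exit times -/

section ExitTime

variable {X : Type*} [TopologicalSpace X] {φ : Flow ℝ X} {B : Set X} {x : X} {t : ℝ}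

lemma le_exitTime (ht : 0 ≤ t) (h : ∀ s ∈ Icc 0 t, φ s x ∈ B) : (t : EReal) ≤ exitTime φ B x :=
  le_sSup ⟨t, ⟨ht, h⟩, rfl⟩

lemma exitTime_nonneg (hx : x ∈ B) : 0 ≤ exitTime φ B x := by
  have := le_exitTime (φ := φ) (B := B) (x := x) le_rfl fun s hs => by
    rw [Icc_self, mem_singleton_iff] at hs
    simpa [hs, φ.map_zero_apply] using hx
  simpa using this

lemma exitTime_ne_bot (hx : x ∈ B) : exitTime φ B x ≠ ⊥ :=
  ((EReal.bot_lt_zero).trans_le (exitTime_nonneg hx)).ne'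

lemma mem_of_lt_exitTime (h : (t : EReal) < exitTime φ B x) : ∀ s ∈ Icc 0 t, φ s x ∈ B := by
  obtain ⟨_, ⟨r, ⟨_, hr⟩, rfl⟩, htr⟩ := lt_sSup_iff.1 h
  exact fun s hs => hr s ⟨hs.1, hs.2.trans (EReal.coe_lt_coe_iff.1 htr).le⟩

/-- The orbit is still in a closed set at the exit time itself. -/
lemma mem_of_le_exitTime (hB : IsClosed B) (hx : x ∈ B) (h : (t : EReal) ≤ exitTime φ B x) :
    ∀ s ∈ Icc 0 t, φ s x ∈ B := by
  intro s hs
  rcases hs.1.eq_or_lt with rfl | hs0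
  · rwa [φ.map_zero_apply]
  have hcont : Continuous fun r => φ r x := by fun_prop
  have hmaps : MapsTo (fun r => φ r x) (Ico 0 s) B := fun r hr =>
    mem_of_lt_exitTime
      ((EReal.coe_lt_coe_iff.2 (hr.2.trans_le hs.2)).trans_le h) r ⟨hr.1, le_rfl⟩
  have := hmaps.closure hcont
  rw [closure_Ico hs0.ne, hB.closure_eq] at this
  exact this ⟨hs0.le, le_rfl⟩

end ExitTime

/-! ### Flows with a strict Lyapunov function -/

/-- The setting of Lyapunov tracing, stripped of linear structure: `p` is a rest point of `φ` in
the compact set `D`, `L` vanishes at `p` and has negative derivative along the flow at every other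
point of `D`, and an orbit at a point of `D` where `L` is positive stays in `D` for a short time,
so that an orbit can leave `D ∩ L ⁻¹' Ici 0` only through the zero set of `L`. -/
structure IsLyapunovTracing {X : Type*} [TopologicalSpace X] (φ : Flow ℝ X) (L : X → ℝ)
    (D : Set X) (p : X) : Prop where
  isCompact : IsCompact D
  continuous : Continuous L
  mem : p ∈ D
  fixed : ∀ t, φ t p = p
  map_eq_zero : L p = 0
  deriv_neg : ∀ x ∈ D, x ≠ p → ∃ v < 0, HasDerivAt (fun t => L (φ t x)) v 0
  eventually_mem : ∀ x ∈ D, 0 < L x → ∀ᶠ t in 𝓝[>] (0 : ℝ), φ t x ∈ D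

namespace IsLyapunovTracing

section Topological

variable {X : Type*} [TopologicalSpace X] {φ : Flow ℝ X} {L : X → ℝ} {D : Set X} {p x : X}
  {a b t : ℝ}

lemma flow_ne (h : IsLyapunovTracing φ L D p) (hx : x ≠ p) (t : ℝ) : φ t x ≠ p := by
  intro ht
  apply hx
  rw [← φ.map_zero_apply x, ← neg_add_cancel t, φ.map_add, ht, h.fixed]

lemma hasDerivAt (h : IsLyapunovTracing φ L D p) (hx : x ≠ p) (ht : φ t x ∈ D) :
    ∃ v < 0, HasDerivAt (fun s => L (φ s x)) v t := by
  obtain ⟨v, hv, hd⟩ := h.deriv_neg _ ht (h.flow_ne hx t)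
  refine ⟨v, hv, ?_⟩
  rw [← sub_self t] at hd
  simpa [← φ.map_add] using hd.comp_sub_const t t

lemma strictAntiOn (h : IsLyapunovTracing φ L D p) (hx : x ≠ p)
    (hD : ∀ t ∈ Icc a b, φ t x ∈ D) : StrictAntiOn (fun t => L (φ t x)) (Icc a b) := by
  refine strictAntiOn_of_deriv_neg (convex_Icc a b) ?_ fun t ht => ?_
  · exact (h.continuous.comp (by fun_prop)).continuousOn
  · obtain ⟨v, hv, hd⟩ := h.hasDerivAt hx (hD t (interior_subset ht))
    rwa [hd.deriv]

lemma le_of_mem (h : IsLyapunovTracing φ L D p) (hab : a ≤ b)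
    (hD : ∀ t ∈ Icc a b, φ t x ∈ D) : L (φ b x) ≤ L (φ a x) := by
  by_cases hx : x = p
  · simp [hx, h.fixed]
  · exact (h.strictAntiOn hx hD).antitoneOn ⟨le_rfl, hab⟩ ⟨hab, le_rfl⟩ hab

lemma eventually_lt (h : IsLyapunovTracing φ L D p) (hx : x ≠ p) (ht : φ t x ∈ D) :
    ∀ᶠ s in 𝓝[>] t, L (φ s x) < L (φ t x) := by
  obtain ⟨v, hv, hd⟩ := h.hasDerivAt hx ht
  have := (hasDerivAt_iff_tendsto_slope.1 hd).eventually (eventually_lt_nhds hv)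
  have hle : 𝓝[>] t ≤ 𝓝[≠] t := nhdsWithin_mono _ fun s hs => ne_of_gt hs
  filter_upwards [hle this, self_mem_nhdsWithin] with s hs hts
  rw [slope_def_field, div_neg_iff] at hs
  have : t < s := hts
  rcases hs with hs | hs <;> linarith [hs.1, hs.2]

end Topological

variable {X : Type*} [MetricSpace X] {φ : Flow ℝ X} {L : X → ℝ} {D : Set X} {p x : X} {a b t : ℝ}

lemma isCompact_inter (h : IsLyapunovTracing φ L D p) : IsCompact (D ∩ L ⁻¹' Ici 0) :=
  h.isCompact.inter_right (isClosed_Ici.preimage h.continuous)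

lemma mem_inter (h : IsLyapunovTracing φ L D p) : p ∈ D ∩ L ⁻¹' Ici 0 :=
  ⟨h.mem, h.map_eq_zero.ge⟩

lemma exitTime_self (h : IsLyapunovTracing φ L D p) : exitTime φ (D ∩ L ⁻¹' Ici 0) p = ⊤ := by
  refine EReal.eq_top_iff_forall_lt _ |>.2 fun t => ?_
  refine (EReal.coe_lt_coe_iff.2 ((lt_add_one t).trans_le (le_max_left _ 0))).trans_le
    (le_exitTime (le_max_right _ _) fun s _ => ?_)
  rw [h.fixed]
  exact h.mem_inter

/-- The set `D ∩ L ⁻¹' Ici 0` can only be left where `L` vanishes: where `L` is positive, the orbit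
goes on inside it. -/
lemma map_flow_exitTime (h : IsLyapunovTracing φ L D p) (hx : x ∈ D ∩ L ⁻¹' Ici 0)
    (ht : exitTime φ (D ∩ L ⁻¹' Ici 0) x = t) : L (φ t x) = 0 := by
  have ht0 : 0 ≤ t := by
    have := exitTime_nonneg (φ := φ) hx
    rw [ht] at this
    exact_mod_cast this
  have hmem := mem_of_le_exitTime h.isCompact_inter.isClosed hx ht.ge
  by_contra hne
  have hz := hmem t ⟨ht0, le_rfl⟩
  have hpos : 0 < L (φ t x) := lt_of_le_of_ne hz.2 (Ne.symm hne)
  have hcont : Continuous fun s => L (φ s (φ t x)) := h.continuous.comp (by fun_prop)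
  have hev : ∀ᶠ s in 𝓝[>] (0 : ℝ), 0 < L (φ s (φ t x)) :=
    nhdsWithin_le_nhds (hcont.continuousAt.eventually
      (lt_mem_nhds (by simpa [φ.map_zero_apply] using hpos)))
  obtain ⟨u, hu, hsub⟩ := mem_nhdsGT_iff_exists_Ioc_subset.1 ((h.eventually_mem _ hz.1 hpos).and hev)
  have hu : 0 < u := hu
  have : ((t + u : ℝ) : EReal) ≤ t := by
    rw [← ht]
    refine le_exitTime (by positivity) fun s hs => ?_
    rcases le_or_gt s t with hst | hst
    · exact hmem s ⟨hs.1, hst⟩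
    · have := hsub (show s - t ∈ Ioc 0 u from ⟨by linarith, by linarith [hs.2]⟩)
      simp only [mem_ofPred_eq, ← φ.map_add, sub_add_cancel] at this
      exact ⟨this.1, this.2.le⟩
  have := EReal.coe_le_coe_iff.1 this
  linarith

/-- An orbit that never leaves `D ∩ L ⁻¹' Ici 0` converges to the rest point: `L` is at least
`L y` along it for each of its limit points `y`, and if `y` were not the rest point, then `L` would
drop below `L y` after a passage near `y`. -/
lemma tendsto_of_exitTime_eq_top (h : IsLyapunovTracing φ L D p)
    (ht : exitTime φ (D ∩ L ⁻¹' Ici 0) x = ⊤) : Tendsto (fun t => φ t x) atTop (𝓝 p) := by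
  have hmem : ∀ t, 0 ≤ t → φ t x ∈ D ∩ L ⁻¹' Ici 0 := fun t h0 =>
    mem_of_lt_exitTime (by rw [ht]; exact EReal.coe_lt_top t) t ⟨h0, le_rfl⟩
  refine h.isCompact.tendsto_nhds_of_unique_mapClusterPt
    ((eventually_ge_atTop 0).mono fun t h0 => (hmem t h0).1) fun y hy hcl => ?_
  by_contra hyp
  have hle : ∀ t, 0 ≤ t → L y ≤ L (φ t x) := by
    intro t h0
    by_contra! hlt
    have hf := hcl.frequently (h.continuous.continuousAt.eventually (lt_mem_nhds hlt))
    obtain ⟨s, hs, hts⟩ := (hf.and_eventually (eventually_ge_atTop t)).exists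
    exact hs.not_ge (h.le_of_mem hts fun r hr => (hmem r (h0.trans hr.1)).1)
  have hev := h.eventually_lt (t := 0) hyp (by rwa [φ.map_zero_apply])
  obtain ⟨s, hs, hs0⟩ := (hev.and self_mem_nhdsWithin).exists
  rw [φ.map_zero_apply] at hs
  have hs0 : 0 < s := hs0
  have hcont : Continuous fun z => L (φ s z) := h.continuous.comp (by fun_prop)
  have hf := hcl.frequently (hcont.continuousAt.eventually (gt_mem_nhds hs))
  obtain ⟨t, ht, h0⟩ := (hf.and_eventually (eventually_ge_atTop 0)).exists
  rw [← φ.map_add] at ht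
  exact ht.not_ge (hle _ (by positivity))

/-! ### Stability of the rest point and continuity of the exit time -/

/-- The rest point is stable for the orbits in `D ∩ L ⁻¹' Ici 0`. For times up to `1` this is
continuity of the flow. A point far from the rest point that ends a unit-time orbit segment inside
the set has `L ≥ 0`, so `L` is bounded below by a positive constant at the beginning of such
segments, which orbits that start with a small value of `L` never attain. -/
lemma exists_stable (h : IsLyapunovTracing φ L D p) {ε : ℝ} (hε : 0 < ε) :
    ∀ᶠ y in 𝓝 p, ∀ t, 0 ≤ t → (∀ s ∈ Icc 0 t, φ s y ∈ D ∩ L ⁻¹' Ici 0) → dist (φ t y) p < ε := by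
  -- The points at distance at least `ε` from `p` whose last unit of orbit is in the set.
  set K : Set X := (⋂ r ∈ Icc (-1 : ℝ) 0, φ r ⁻¹' (D ∩ L ⁻¹' Ici 0)) ∩ {z | ε ≤ dist z p} with hK
  have hKsub : K ⊆ D ∩ L ⁻¹' Ici 0 := fun z hz => by
    have := mem_iInter₂.1 hz.1 0 (by simp)
    rwa [mem_preimage, φ.map_zero_apply] at this
  have hKc : IsCompact K := by
    refine h.isCompact_inter.of_isClosed_subset (IsClosed.inter ?_ ?_) hKsub
    · exact isClosed_biInter fun r _ =>
        h.isCompact_inter.isClosed.preimage (φ.continuous_toFun r)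
    · exact isClosed_le continuous_const (by fun_prop)
  have hcont : Continuous fun z => L (φ (-1) z) := h.continuous.comp (by fun_prop)
  have hpos : ∀ z ∈ K, 0 < L (φ (-1) z) := by
    intro z hz
    have hzp : z ≠ p := by
      rintro rfl
      have : ε ≤ dist z z := hz.2
      rw [dist_self] at this
      linarith
    have := h.strictAntiOn (a := -1) (b := 0) hzp (fun r hr => (mem_iInter₂.1 hz.1 r hr).1)
      (by simp) (by simp) (show (-1 : ℝ) < 0 by norm_num)
    simp only [φ.map_zero_apply] at this
    exact (hKsub hz).2.trans_lt this
  obtain ⟨c, hc, hcK⟩ : ∃ c > 0, ∀ z ∈ K, c ≤ L (φ (-1) z) := by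
    rcases K.eq_empty_or_nonempty with hKe | hKne
    · exact ⟨1, one_pos, by simp [hKe]⟩
    · obtain ⟨z, hz, hmin⟩ := hKc.exists_isMinOn hKne hcont.continuousOn
      exact ⟨_, hpos z hz, fun w hw => hmin hw⟩
  have hshort : ∀ᶠ y in 𝓝 p, ∀ t ∈ Icc (0 : ℝ) 1, dist (φ t y) p < ε := by
    refine isCompact_Icc.eventually_forall_of_forall_eventually fun t _ => ?_
    have : Continuous fun z : X × ℝ => dist (φ z.2 z.1) p := by fun_prop
    exact this.continuousAt.eventually (gt_mem_nhds (by simpa [h.fixed] using hε))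
  have hsmall : ∀ᶠ y in 𝓝 p, L y < c :=
    h.continuous.continuousAt.eventually (gt_mem_nhds (by rwa [h.map_eq_zero]))
  filter_upwards [hshort, hsmall] with y hy hyc t ht hmem
  rcases le_or_gt t 1 with h1 | h1
  · exact hy t ⟨ht, h1⟩
  by_contra! hfar
  -- Now `φ t y ∈ K`, so `L` is at least `c` at time `t - 1`, but `L y < c` and `L` decreases.
  have hle := hcK (φ t y) ⟨mem_iInter₂.2 fun r hr => ?_, hfar⟩
  · rw [← φ.map_add] at hle
    have := h.le_of_mem (a := 0) (b := -1 + t) (x := y) (by linarith)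
      fun s hs => (hmem s ⟨hs.1, by linarith [hs.2]⟩).1
    rw [φ.map_zero_apply] at this
    linarith
  · rw [mem_preimage, ← φ.map_add]
    exact hmem _ ⟨by linarith [hr.1], by linarith [hr.2]⟩

/-- The exit time from `D ∩ L ⁻¹' Ici 0` is lower semicontinuous away from the rest point: `L`
stays positive on a compact time interval before the exit, also for nearby orbits. -/
lemma eventually_lt_exitTime (h : IsLyapunovTracing φ L D p) (hxp : x ≠ p)
    {a : EReal} (ha : a < exitTime φ (D ∩ L ⁻¹' Ici 0) x) :
    ∀ᶠ y in 𝓝[D ∩ L ⁻¹' Ici 0] x, a < exitTime φ (D ∩ L ⁻¹' Ici 0) y := by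
  obtain ⟨c, hac, hc⟩ := EReal.lt_iff_exists_real_btwn.1 ha
  suffices ∀ᶠ y in 𝓝[D ∩ L ⁻¹' Ici 0] x, (c : EReal) < exitTime φ (D ∩ L ⁻¹' Ici 0) y from
    this.mono fun y hy => hac.trans hy
  obtain ⟨d, hcd, hd⟩ := EReal.lt_iff_exists_real_btwn.1 hc
  have hcd := EReal.coe_lt_coe_iff.1 hcd
  have hanti := h.strictAntiOn hxp fun t ht => (mem_of_lt_exitTime hd t ht).1
  have hpos : ∀ s ∈ Icc 0 c, 0 < L (φ s x) := by
    intro s hs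
    have hd0 : (0 : ℝ) ≤ d := by linarith [hs.1, hs.2]
    exact (mem_of_lt_exitTime hd d ⟨hd0, le_rfl⟩).2.trans_lt
      (hanti ⟨hs.1, by linarith [hs.2]⟩ ⟨hd0, le_rfl⟩ (by linarith [hs.2]))
  have hev : ∀ᶠ y in 𝓝 x, ∀ s ∈ Icc 0 c, 0 < L (φ s y) := by
    refine isCompact_Icc.eventually_forall_of_forall_eventually fun s hs => ?_
    have : Continuous fun z : X × ℝ => L (φ z.2 z.1) := h.continuous.comp (by fun_prop)
    exact this.continuousAt.eventually (lt_mem_nhds (hpos s hs))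
  filter_upwards [nhdsWithin_le_nhds hev, self_mem_nhdsWithin] with y hy hyB
  by_contra! hle
  lift exitTime φ (D ∩ L ⁻¹' Ici 0) y to ℝ using
    ⟨(hle.trans_lt (EReal.coe_lt_top c)).ne, exitTime_ne_bot hyB⟩ with τ hτ
  have h0 := exitTime_nonneg (φ := φ) hyB
  rw [← hτ] at h0
  exact (hy τ ⟨EReal.coe_nonneg.1 h0, EReal.coe_le_coe_iff.1 hle⟩).ne'
    (h.map_flow_exitTime hyB hτ.symm)

/-- The exit time from `D ∩ L ⁻¹' Ici 0` is upper semicontinuous away from the rest point: right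
after the exit `L` is negative, also for nearby orbits. -/
lemma eventually_exitTime_lt (h : IsLyapunovTracing φ L D p) (hx : x ∈ D ∩ L ⁻¹' Ici 0)
    (hxp : x ≠ p) {a : EReal} (ha : exitTime φ (D ∩ L ⁻¹' Ici 0) x < a) :
    ∀ᶠ y in 𝓝 x, exitTime φ (D ∩ L ⁻¹' Ici 0) y < a := by
  obtain ⟨c, hc, hca⟩ := EReal.lt_iff_exists_real_btwn.1 ha
  have h0 := exitTime_nonneg (φ := φ) hx
  obtain ⟨τ, hτ⟩ : ∃ τ : ℝ, exitTime φ (D ∩ L ⁻¹' Ici 0) x = τ := by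
    lift exitTime φ (D ∩ L ⁻¹' Ici 0) x to ℝ using
      ⟨(hc.trans (EReal.coe_lt_top c)).ne, exitTime_ne_bot hx⟩ with τ
    exact ⟨τ, rfl⟩
  rw [hτ] at hc h0
  have hτ0 : 0 ≤ τ := EReal.coe_nonneg.1 h0
  have hτc : τ < c := EReal.coe_lt_coe_iff.1 hc
  have hev := h.eventually_lt hxp (mem_of_le_exitTime h.isCompact_inter.isClosed hx hτ.ge τ
    ⟨hτ0, le_rfl⟩).1
  rw [h.map_flow_exitTime hx hτ] at hev
  obtain ⟨s, hs, hsI⟩ := (hev.and (Ioo_mem_nhdsGT hτc)).exists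
  have hcont : Continuous fun z => L (φ s z) := h.continuous.comp (by fun_prop)
  filter_upwards [hcont.continuousAt.eventually (gt_mem_nhds hs)] with y hy
  refine lt_of_le_of_lt ?_ ((EReal.coe_lt_coe_iff.2 hsI.2).trans hca)
  by_contra! hlt
  exact hy.not_ge (mem_of_lt_exitTime hlt s ⟨by linarith [hsI.1], le_rfl⟩).2

lemma continuousWithinAt_exitTime (h : IsLyapunovTracing φ L D p) (hx : x ∈ D ∩ L ⁻¹' Ici 0)
    (hxp : x ≠ p) :
    ContinuousWithinAt (exitTime φ (D ∩ L ⁻¹' Ici 0)) (D ∩ L ⁻¹' Ici 0) x :=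
  tendsto_order.2 ⟨fun _ ha => h.eventually_lt_exitTime hxp ha,
    fun _ ha => nhdsWithin_le_nhds (h.eventually_exitTime_lt hx hxp ha)⟩

lemma exitTime_eq_zero (h : IsLyapunovTracing φ L D p) (hx : x ∈ L ⁻¹' {0} ∩ D) (hxp : x ≠ p) :
    exitTime φ (D ∩ L ⁻¹' Ici 0) x = 0 := by
  have hx0 : L x = 0 := hx.1
  refine le_antisymm ?_ (exitTime_nonneg ⟨hx.2, hx0.ge⟩)
  by_contra! hlt
  obtain ⟨t, h0, ht⟩ := EReal.lt_iff_exists_real_btwn.1 hlt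
  have h0 : 0 < t := EReal.coe_pos.1 h0
  have hmem := mem_of_lt_exitTime ht
  have := h.strictAntiOn hxp (fun s hs => (hmem s hs).1) ⟨le_rfl, h0.le⟩ ⟨h0.le, le_rfl⟩ h0
  simp only [φ.map_zero_apply, hx0] at this
  exact this.not_ge (hmem t ⟨h0.le, le_rfl⟩).2

end IsLyapunovTracing

/-! ### The flow stopped at the exit time -/

open Classical in
/-- The point reached from `x` at the extended time `T`, where time `⊤` stands for the limit of the
orbit. At `T = ⊥` it has the junk value `x`. -/
noncomputable def extendedFlow {X : Type*} [TopologicalSpace X] [Nonempty X] (φ : Flow ℝ X)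
    (T : EReal) (x : X) : X :=
  if T = ⊤ then limUnder atTop (fun t : ℝ => φ t x) else φ T.toReal x

/-- The orbit of `x` followed up to the extended time `T`, but stopped when it leaves `B`. -/
noncomputable def stoppedFlow {X : Type*} [TopologicalSpace X] [Nonempty X] (φ : Flow ℝ X)
    (B : Set X) (T : EReal) (x : X) : X :=
  extendedFlow φ (min (exitTime φ B x) T) x

section StoppedFlow

variable {X : Type*} [TopologicalSpace X] [Nonempty X] (φ : Flow ℝ X) (x : X)

lemma extendedFlow_coe (t : ℝ) : extendedFlow φ t x = φ t x := by
  simp [extendedFlow]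

lemma extendedFlow_of_ne_top {T : EReal} (hT : T ≠ ⊤) : extendedFlow φ T x = φ T.toReal x := by
  simp [extendedFlow, hT]

lemma stoppedFlow_top (B : Set X) : stoppedFlow φ B ⊤ x = exitMap φ B x := by
  rw [stoppedFlow, min_top_right]
  rfl

end StoppedFlow

namespace IsLyapunovTracing

variable {X : Type*} [MetricSpace X] [Nonempty X] {φ : Flow ℝ X} {L : X → ℝ} {D : Set X} {p x : X}
  {T : EReal}

lemma extendedFlow_top (h : IsLyapunovTracing φ L D p)
    (hx : exitTime φ (D ∩ L ⁻¹' Ici 0) x = ⊤) : extendedFlow φ ⊤ x = p := by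
  simpa [extendedFlow] using (h.tendsto_of_exitTime_eq_top hx).limUnder_eq

lemma stoppedFlow_mem (h : IsLyapunovTracing φ L D p) (hx : x ∈ D ∩ L ⁻¹' Ici 0) (hT : 0 ≤ T) :
    stoppedFlow φ (D ∩ L ⁻¹' Ici 0) T x ∈ D ∩ L ⁻¹' Ici 0 := by
  by_cases hm : min (exitTime φ (D ∩ L ⁻¹' Ici 0) x) T = ⊤
  · rw [stoppedFlow, hm, h.extendedFlow_top (min_eq_top.1 hm).1]
    exact h.mem_inter
  · have h0 : 0 ≤ min (exitTime φ (D ∩ L ⁻¹' Ici 0) x) T := le_min (exitTime_nonneg hx) hT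
    rw [stoppedFlow, extendedFlow_of_ne_top _ _ hm]
    refine mem_of_le_exitTime h.isCompact_inter.isClosed hx ?_ _ ⟨EReal.toReal_nonneg h0, le_rfl⟩
    rw [EReal.coe_toReal hm (EReal.bot_lt_zero.trans_le h0).ne']
    exact min_le_left _ _

lemma exitMap_mem (h : IsLyapunovTracing φ L D p) (hx : x ∈ D ∩ L ⁻¹' Ici 0) :
    exitMap φ (D ∩ L ⁻¹' Ici 0) x ∈ L ⁻¹' {0} ∩ D := by
  rw [← stoppedFlow_top]
  refine ⟨?_, (h.stoppedFlow_mem hx le_top).1⟩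
  rw [stoppedFlow, min_top_right, mem_preimage, mem_singleton_iff]
  by_cases hm : exitTime φ (D ∩ L ⁻¹' Ici 0) x = ⊤
  · rw [hm, h.extendedFlow_top hm, h.map_eq_zero]
  · rw [extendedFlow_of_ne_top _ _ hm]
    exact h.map_flow_exitTime hx (EReal.coe_toReal hm (exitTime_ne_bot hx)).symm

lemma stoppedFlow_of_map_eq_zero (h : IsLyapunovTracing φ L D p) (hx : x ∈ L ⁻¹' {0} ∩ D)
    (hT : 0 ≤ T) : stoppedFlow φ (D ∩ L ⁻¹' Ici 0) T x = x := by
  by_cases hxp : x = p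
  · rw [hxp, stoppedFlow, h.exitTime_self, min_top_left]
    by_cases hm : T = ⊤
    · rw [hm, h.extendedFlow_top h.exitTime_self]
    · rw [extendedFlow_of_ne_top _ _ hm, h.fixed]
  · rw [stoppedFlow, h.exitTime_eq_zero hx hxp, min_eq_left hT]
    simpa [φ.map_zero_apply] using extendedFlow_coe φ x 0

/-- If the orbit of `y` is in the stability neighbourhood of the rest point at some time before it
is stopped, then it is stopped near the rest point. -/
lemma dist_stoppedFlow_lt (h : IsLyapunovTracing φ L D p) {ε t : ℝ} (hε : 0 < ε) {y : X}
    (hy : y ∈ D ∩ L ⁻¹' Ici 0) (ht : 0 ≤ t)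
    (htm : (t : EReal) ≤ min (exitTime φ (D ∩ L ⁻¹' Ici 0) y) T)
    (hstable : ∀ s, 0 ≤ s → (∀ r ∈ Icc 0 s, φ r (φ t y) ∈ D ∩ L ⁻¹' Ici 0) →
      dist (φ s (φ t y)) p < ε) :
    dist (stoppedFlow φ (D ∩ L ⁻¹' Ici 0) T y) p < ε := by
  rw [stoppedFlow]
  have hle := min_le_left (exitTime φ (D ∩ L ⁻¹' Ici 0) y) T
  generalize hm : min (exitTime φ (D ∩ L ⁻¹' Ici 0) y) T = m at *
  induction m with
  | bot => exact absurd htm (by simp)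
  | top =>
    rw [h.extendedFlow_top (top_le_iff.1 hle), dist_self]
    exact hε
  | coe m =>
    have htm := EReal.coe_le_coe_iff.1 htm
    rw [extendedFlow_coe]
    have := hstable (m - t) (by linarith) fun r hr => by
      rw [← φ.map_add]
      exact mem_of_le_exitTime h.isCompact_inter.isClosed hy hle _
        ⟨by linarith [hr.1], by linarith [hr.2]⟩
    rwa [← φ.map_add, sub_add_cancel] at this

/-- The stopped flow is jointly continuous in the point and the extended time. Where the orbit is
stopped after a finite time this is continuity of the exit time; at the rest point, and where the
orbit is followed for infinite time, it is stability of the rest point. -/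
theorem continuousOn_stoppedFlow (h : IsLyapunovTracing φ L D p) :
    ContinuousOn (fun q : X × EReal => stoppedFlow φ (D ∩ L ⁻¹' Ici 0) q.2 q.1)
      ((D ∩ L ⁻¹' Ici 0) ×ˢ Ici 0) := by
  rintro ⟨x, T⟩ ⟨hx, hT⟩
  simp only at hx hT
  have hT : 0 ≤ T := hT
  have hfst : Tendsto Prod.fst (𝓝[(D ∩ L ⁻¹' Ici 0) ×ˢ Ici 0] (x, T)) (𝓝[D ∩ L ⁻¹' Ici 0] x) :=
    (continuousWithinAt_fst.tendsto_nhdsWithin fun q hq => hq.1)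
  have hsnd : Tendsto Prod.snd (𝓝[(D ∩ L ⁻¹' Ici 0) ×ˢ Ici 0] (x, T)) (𝓝 T) :=
    continuousWithinAt_snd
  -- Continuity at `(x, T)` when the stopped flow takes the value `p` there, given a time `t` at
  -- which the orbit of `x` is in the stability neighbourhood and nearby orbits are not yet stopped.
  have key : (∀ V ∈ 𝓝 p, ∃ t : ℝ, 0 ≤ t ∧ φ t x ∈ interior V ∧
        ∀ᶠ q in 𝓝[(D ∩ L ⁻¹' Ici 0) ×ˢ Ici 0] (x, T),
          (t : EReal) ≤ min (exitTime φ (D ∩ L ⁻¹' Ici 0) q.1) q.2) →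
      stoppedFlow φ (D ∩ L ⁻¹' Ici 0) T x = p →
      ContinuousWithinAt (fun q : X × EReal => stoppedFlow φ (D ∩ L ⁻¹' Ici 0) q.2 q.1)
        ((D ∩ L ⁻¹' Ici 0) ×ˢ Ici 0) (x, T) := by
    intro hkey hval
    refine Metric.tendsto_nhds.2 fun ε hε => ?_
    simp only [hval]
    obtain ⟨t, ht, htV, hev⟩ := hkey _ (h.exists_stable hε)
    have hV : ∀ᶠ q in 𝓝[(D ∩ L ⁻¹' Ici 0) ×ˢ Ici 0] (x, T), φ t q.1 ∈ interior _ :=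
      (((φ.continuous_toFun t).continuousAt.tendsto.mono_left nhdsWithin_le_nhds).comp
        hfst).eventually (isOpen_interior.mem_nhds htV)
    filter_upwards [hev, hV, self_mem_nhdsWithin] with q hq hqV hqB
    exact h.dist_stoppedFlow_lt hε hqB.1 ht hq (interior_subset hqV)
  by_cases hxp : x = p
  · refine key (fun V hV => ⟨0, le_rfl, ?_, ?_⟩) ?_
    · rw [φ.map_zero_apply, hxp]
      exact mem_interior_iff_mem_nhds.2 hV
    · filter_upwards [self_mem_nhdsWithin] with q hq
      exact le_min (exitTime_nonneg hq.1) hq.2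
    · rw [hxp]
      exact h.stoppedFlow_of_map_eq_zero ⟨h.map_eq_zero, h.mem⟩ hT
  have hτ : Tendsto (fun q : X × EReal => min (exitTime φ (D ∩ L ⁻¹' Ici 0) q.1) q.2)
      (𝓝[(D ∩ L ⁻¹' Ici 0) ×ˢ Ici 0] (x, T)) (𝓝 (min (exitTime φ (D ∩ L ⁻¹' Ici 0) x) T)) :=
    ((h.continuousWithinAt_exitTime hx hxp).tendsto.comp hfst).min hsnd
  by_cases hm : min (exitTime φ (D ∩ L ⁻¹' Ici 0) x) T = ⊤
  · have hxτ := (min_eq_top.1 hm).1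
    refine key (fun V hV => ?_) ?_
    · have := (h.tendsto_of_exitTime_eq_top hxτ).eventually
        (isOpen_interior.mem_nhds (mem_interior_iff_mem_nhds.2 hV))
      obtain ⟨t, htV, ht⟩ := (this.and (eventually_ge_atTop 0)).exists
      refine ⟨t, ht, htV, (hτ.eventually (lt_mem_nhds ?_)).mono fun q hq => hq.le⟩
      rw [hm]
      exact EReal.coe_lt_top t
    · rw [stoppedFlow, hm, h.extendedFlow_top hxτ]
  · have hbot : min (exitTime φ (D ∩ L ⁻¹' Ici 0) x) T ≠ ⊥ :=
      (EReal.bot_lt_zero.trans_le (le_min (exitTime_nonneg hx) hT)).ne'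
    have hreal := (EReal.tendsto_toReal hm hbot).comp hτ
    have hφ : Continuous fun z : ℝ × X => φ z.1 z.2 := by fun_prop
    have := (hφ.continuousAt (x := (_, x))).tendsto.comp
      (hreal.prodMk_nhds (hfst.mono_right nhdsWithin_le_nhds))
    simp only [ContinuousWithinAt, stoppedFlow, extendedFlow_of_ne_top _ _ hm]
    refine this.congr' ?_
    filter_upwards [hτ.eventually (gt_mem_nhds (lt_top_iff_ne_top.2 hm))] with q hq
    rw [extendedFlow_of_ne_top _ _ hq.ne]
    rfl

theorem continuousOn_exitMap (h : IsLyapunovTracing φ L D p) :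
    ContinuousOn (exitMap φ (D ∩ L ⁻¹' Ici 0)) (D ∩ L ⁻¹' Ici 0) := by
  have := h.continuousOn_stoppedFlow.comp (f := fun x => (x, ⊤)) (s := D ∩ L ⁻¹' Ici 0)
    (by fun_prop) fun x hx => ⟨hx, le_top (α := EReal)⟩
  exact this.congr fun x _ => (stoppedFlow_top φ x _).symm

/-- The deformation follows each orbit up to the exit time, with `[0, 1]` as time scale: the
parameter `s` stands for the time `s / (1 - s)`, which is infinite at `s = 1`. -/
theorem isStrongDeformationRetract (h : IsLyapunovTracing φ L D p) :
    IsStrongDeformationRetract (L ⁻¹' {0} ∩ D) (D ∩ L ⁻¹' Ici 0) := by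
  set θ : ℝ → EReal := fun s => ((ENNReal.ofReal s / ENNReal.ofReal (1 - s) : ENNReal) : EReal)
    with hθ
  have hθc : Continuous θ := by
    refine continuous_coe_ennreal_ereal.comp (continuous_iff_continuousAt.2 fun s => ?_)
    refine ENNReal.Tendsto.div (ENNReal.continuous_ofReal.continuousAt) ?_
      (ENNReal.continuous_ofReal.comp (by fun_prop : Continuous fun s : ℝ => 1 - s)).continuousAt
      (Or.inl ENNReal.ofReal_ne_top)
    rcases le_or_gt s 0 with hs | hs
    · exact Or.inr (ENNReal.ofReal_pos.2 (by linarith)).ne'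
    · exact Or.inl (ENNReal.ofReal_pos.2 hs).ne'
  have hθ0 : ∀ s, 0 ≤ θ s := fun s => EReal.coe_ennreal_nonneg _
  have hθ_zero : θ 0 = 0 := by simp [hθ]
  have hθ_one : θ 1 = ⊤ := by simp [hθ]
  refine ⟨fun x hx => ⟨hx.2, (show L x = 0 from hx.1).ge⟩,
    fun q => stoppedFlow φ (D ∩ L ⁻¹' Ici 0) (θ q.2) q.1, ?_, fun q hq => ?_, fun x hx s _ => ?_,
    fun x hx => ?_, fun x hx => ?_⟩
  · exact h.continuousOn_stoppedFlow.comp (f := fun q : X × ℝ => (q.1, θ q.2))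
      (by fun_prop) fun q hq => ⟨hq.1, hθ0 q.2⟩
  · exact h.stoppedFlow_mem hq.1 (hθ0 _)
  · exact h.stoppedFlow_of_map_eq_zero hx (hθ0 s)
  · simp only [hθ_one, stoppedFlow_top]
    exact h.exitMap_mem hx
  · simp only [hθ_zero, stoppedFlow, min_eq_right (exitTime_nonneg hx)]
    simpa [φ.map_zero_apply] using extendedFlow_coe φ x 0

end IsLyapunovTracing

/-! ### Quadratic Lyapunov functions with immediate entrances -/

/-- An equilibrium of a `C¹` vector field is a rest point of its flow. The times at which the flow
fixes it form an additive subgroup of `ℝ`, which is open by local uniqueness of solutions. -/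
lemma IsFlowOf.eq_of_eq_zero {E : Type*} [NormedAddCommGroup E] [NormedSpace ℝ E] {f : E → E}
    {φ : Flow ℝ E} (hφ : IsFlowOf f φ) {x : E} (hf : ContDiffAt ℝ 1 f x) (hx : f x = 0) (t : ℝ) :
    φ t x = x := by
  obtain ⟨K, U, hU, hK⟩ := hf.exists_lipschitzOnWith
  have hcont : Continuous fun s => φ s x := by fun_prop
  have hev : ∀ᶠ s in 𝓝 (0 : ℝ), φ s x ∈ U :=
    hcont.continuousAt.eventually (by simpa [φ.map_zero_apply] using hU)
  have heq : (fun s => φ s x) =ᶠ[𝓝 0] fun _ => x := by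
    refine ODE_solution_unique_of_eventually (v := fun _ => f) (s := fun _ => U) (K := K)
      (Eventually.of_forall fun _ => hK) (hev.mono fun s hs => ⟨hφ x s, hs⟩)
      (Eventually.of_forall fun s => ⟨?_, mem_of_mem_nhds hU⟩) (φ.map_zero_apply x)
    rw [hx]
    exact hasDerivAt_const s x
  let H : AddSubgroup ℝ :=
    { carrier := {s | φ s x = x}
      add_mem' := fun {a b} (ha : φ a x = x) (hb : φ b x = x) => by
        change φ (a + b) x = x
        rw [φ.map_add, hb, ha]
      zero_mem' := φ.map_zero_apply x
      neg_mem' := fun {a} (ha : φ a x = x) => by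
        change φ (-a) x = x
        nth_rw 1 [← ha]
        rw [← φ.map_add, neg_add_cancel, φ.map_zero_apply] }
  have hopen : IsOpen (H : Set ℝ) := H.isOpen_of_mem_nhds (g := 0) heq
  have huniv : (H : Set ℝ) = univ :=
    IsClopen.eq_univ ⟨H.isClosed_of_isOpen hopen, hopen⟩ ⟨0, H.zero_mem⟩
  exact (huniv ▸ mem_univ t : t ∈ (H : Set ℝ))

/-- Off the equilibria a Lyapunov function is differentiable along the orbit with negative
derivative; the value of `deriv` in `IsLyapunovOn` is never a junk value. -/
lemma IsLyapunovOn.exists_hasDerivAt {E : Type*} [NormedAddCommGroup E] [NormedSpace ℝ E]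
    {f : E → E} {φ : Flow ℝ E} (hφ : IsFlowOf f φ) {L : E → ℝ} {D : Set E}
    (hL : IsLyapunovOn f φ L D) {x : E} (hx : x ∈ D) (hfx : f x ≠ 0) :
    ∃ v < 0, HasDerivAt (fun t : ℝ => L (φ t x)) v 0 := by
  obtain ⟨U, hU, hDU, hLU⟩ := hL.contDiffOn
  have hdL : DifferentiableAt ℝ L (φ 0 x) := by
    rw [φ.map_zero_apply]
    exact (hLU.contDiffAt (hU.mem_nhds (hDU hx))).differentiableAt one_ne_zero
  have hd : DifferentiableAt ℝ (fun t : ℝ => L (φ t x)) 0 :=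
    DifferentiableAt.comp (0 : ℝ) hdL (hφ x 0).differentiableAt
  exact ⟨_, lt_of_le_of_ne (hL.deriv_nonpos x hx)
    fun h0 => hfx (hL.equilibrium_of_deriv_eq_zero x hx h0), hd.hasDerivAt⟩

lemma continuous_quadForm {n : ℕ} (Y : Matrix (Fin n) (Fin n) ℝ) (x₀ : EuclideanSpace ℝ (Fin n)) :
    Continuous (quadForm Y x₀) := by
  unfold quadForm
  fun_prop

/-- A point of `D` where `L` is positive is interior to that part of `D` or an immediate entrance,
so its orbit stays in `D` for a short time. -/
lemma eventually_mem_of_frontier_eq {X : Type*} [TopologicalSpace X] {φ : Flow ℝ X} {L : X → ℝ}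
    {D : Set X} {ι : Type*} {S : ι → Set X}
    (hbdry : frontier (D ∩ L ⁻¹' Ioi 0) = (L ⁻¹' {0} ∩ D) ∪ ⋃ i, S i)
    (hS : ∀ i, IsImmediateEntrance φ (D ∩ L ⁻¹' Ioi 0) (S i)) {x : X} (hx : x ∈ D) (h0 : 0 < L x) :
    ∀ᶠ t in 𝓝[>] (0 : ℝ), φ t x ∈ D := by
  by_cases hint : x ∈ interior (D ∩ L ⁻¹' Ioi 0)
  · have hcont : Continuous fun t => φ t x := by fun_prop
    have hev : ∀ᶠ t in 𝓝 (0 : ℝ), φ t x ∈ interior (D ∩ L ⁻¹' Ioi 0) :=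
      hcont.continuousAt.eventually (isOpen_interior.mem_nhds (by simpa only [φ.map_zero_apply]))
    filter_upwards [nhdsWithin_le_nhds hev] with t ht
    exact (interior_subset ht).1
  · have hfr : x ∈ frontier (D ∩ L ⁻¹' Ioi 0) := ⟨subset_closure ⟨hx, h0⟩, hint⟩
    rw [hbdry] at hfr
    rcases hfr with hfr | hfr
    · exact absurd hfr.1 h0.ne'
    · obtain ⟨i, hi⟩ := mem_iUnion.1 hfr
      obtain ⟨ε, hε, hin, _⟩ := hS i x hi
      filter_upwards [Ioo_mem_nhdsGT hε] with t ht
      exact (interior_subset (hin t ht)).1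

theorem mainTheorem5 {n : ℕ}
    (f : EuclideanSpace ℝ (Fin n) → EuclideanSpace ℝ (Fin n)) (hf : ContDiff ℝ 1 f)
    (φ : Flow ℝ (EuclideanSpace ℝ (Fin n))) (hφ : IsFlowOf f φ)
    (xs : EuclideanSpace ℝ (Fin n)) (hxs : f xs = 0)
    (Y : Matrix (Fin n) (Fin n) ℝ) (hY : Y.IsSymm)
    (D : Set (EuclideanSpace ℝ (Fin n))) (hD : IsCompact D)
    (hstar : ∃ c ∈ D, StarConvex ℝ c D) (hxsD : xs ∈ D)
    (hL : IsLyapunovOn f φ (quadForm Y xs) D)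
    (huniq : ∀ x ∈ D, f x = 0 → x = xs)
    {ι : Type*} (S : ι → Set (EuclideanSpace ℝ (Fin n)))
    (hbdry : frontier (D ∩ quadForm Y xs ⁻¹' Ioi 0) =
      (quadForm Y xs ⁻¹' {0} ∩ D) ∪ ⋃ i, S i)
    (hS : ∀ i, IsImmediateEntrance φ (D ∩ quadForm Y xs ⁻¹' Ioi 0) (S i)) :
    (∀ x ∈ D ∩ quadForm Y xs ⁻¹' Ici 0,
      exitTime φ (D ∩ quadForm Y xs ⁻¹' Ici 0) x = ⊤ →
        Tendsto (fun t : ℝ => φ t x) atTop (𝓝 xs)) ∧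
    MapsTo (exitMap φ (D ∩ quadForm Y xs ⁻¹' Ici 0))
      (D ∩ quadForm Y xs ⁻¹' Ici 0) (quadForm Y xs ⁻¹' {0} ∩ D) ∧
    ContinuousOn (exitMap φ (D ∩ quadForm Y xs ⁻¹' Ici 0))
      (D ∩ quadForm Y xs ⁻¹' Ici 0) ∧
    IsStrongDeformationRetract (quadForm Y xs ⁻¹' {0} ∩ D)
      (D ∩ quadForm Y xs ⁻¹' Ici 0) := by
  have h : IsLyapunovTracing φ (quadForm Y xs) D xs :=
    { isCompact := hD
      continuous := continuous_quadForm Y xs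
      mem := hxsD
      fixed := hφ.eq_of_eq_zero hf.contDiffAt hxs
      map_eq_zero := by simp [quadForm]
      deriv_neg := fun x hx hne => hL.exists_hasDerivAt hφ hx fun h0 => hne (huniq x hx h0)
      eventually_mem := fun x hx h0 => eventually_mem_of_frontier_eq hbdry hS hx h0 }
  exact ⟨fun x _ => h.tendsto_of_exitTime_eq_top, fun x => h.exitMap_mem, h.continuousOn_exitMap,
    h.isStrongDeformationRetract⟩
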